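/- Let $\mathbf A\in\{0,1\}^{m\times n}$, $\mathbf b\in\mathbb R_{\ge 0}^m$, $\mathbf w\in\mathbb R^n$, $\mathbf X\in\mathbb N^n$, and let $\mathcal P=\{\mathbf x\in\mathbb R^n : 0\le x_i\le X_i \text{ for all } i,\ \mathbf A\mathbf x\le \mathbf b\}$. **Algorithm min-sum-packing.** Let $G$ be the bipartite graph with variable vertices $v_1,\dots,v_n$ (the columns of $\mathbf A$), constraint vertices $C_1,\dots,C_m$ (the rows of $\mathbf A$), and an edge $(v_i,C_j)$ exactly when $A_{ji}=1$. Let $N(\cdot)$ denote the set of neighbours in $G$, and write $w_v,X_v$ and $b_C$ for the entries belonging to $v$ and $C$. Messages take values in $\mathbb R\cup\{-\infty\}$, and a maximum over the empty set is $-\infty$. Given a number of iterations $t\in\mathbb N$, put $\mu^{(0)}_{C\to v}(\beta)=0$ for every edge $(v,C)$ and every $\beta\in\{0,\dots,X_v\}$. For $t'=1,\dots,t$, every edge $(v,C)$ and every $\beta\in\{0,\dots,X_v\}$, put $$\mu^{(t')}_{v\to C}(\beta)=w_v\beta+\sum_{C'\in N(v)\setminus\{C\}}\mu^{(t'-1)}_{C'\to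 v}(\beta),$$ $$\mu^{(t')}_{C\to v}(\beta)=\max\Big\{\sum_{u\in N(C)\setminus\{v\}}\mu^{(t')}_{u\to C}(z_u)\ :\ \mathbf z\in\prod_{u}\{0,\dots,X_u\},\ z_v=\beta,\ \sum_{u\in N(C)}z_u\le b_C\Big\}.$$ Finally, put $$\mu_v(\beta)=w_v\beta+\sum_{C\in N(v)}\mu^{(t)}_{C\to v}(\beta),$$ let $\delta_{v,t}$ be the set of the $\beta\in\{0,\dots,X_v\}$ that maximize $\mu_v$, and output the vector $\hat{\mathbf x}$ with $\hat x_v=\max\delta_{v,t}$ if $t$ is even and $\hat x_v=\min\delta_{v,t}$ if $t$ is odd. **Theorem.** Assume that every column of $\mathbf A$ contains at most two $1$s, and that the packing linear program $\max\{\mathbf w^T\mathbf x : \mathbf x\in\mathcal P\}$ has a unique optimal solution $\mathbf x^*$, with $x^*_i\in\{0,X_i\}$ for every $i$. Let $w_{\max}=\max_i w_i$ and $$c(\mathcal P,\mathbf w)=\min_{\mathbf x\in\mathcal P\setminus\{\mathbf x^*\}}\frac{\mathbf w^T(\mathbf x^*-\mathbf x)}{\|\mathbf x^*-\mathbf x\|_1},$$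 where $w_{\max}/c(\mathcal P,\mathbf w)$ is read as $0$ if $\mathcal P=\{\mathbf x^*\}$. If $t\in\mathbb N$ satisfies $t>\dfrac{w_{\max}}{c(\mathcal P,\mathbf w)}+\dfrac12$, then the output of min-sum-packing with $t$ iterations is $\hat{\mathbf x}=\mathbf x^*$. -/

import Mathlib

namespace MinSumPacking

/-- A factor graph model `⟨G, Ψ, Φ, X⟩` with variable vertices `V` and constraint vertices `C`.
The bipartite graph `G` is given by its edge set `E ⊆ V × C`; the alphabet of the variable
vertex `v` is `{0, …, X v}`; factor functions may take the value `-∞`, written `⊥`. -/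
structure FactorGraphModel (V C : Type*) where
  /-- the edges of the bipartite graph -/
  E : Finset (V × C)
  /-- the factor functions, one for each constraint vertex -/
  ψ : C → (V → ℕ) → WithBot ℝ
  /-- the variable functions, one for each variable vertex -/
  φ : V → ℝ → ℝ
  /-- the domain boundary vector -/
  X : V → ℕ

/-- The integral box `{0, …, X₁} × ⋯ × {0, …, Xₙ}`. -/
noncomputable def zbox {V : Type*} [Fintype V] (X : V → ℕ) : Finset (V → ℕ) :=
  open Classical in Fintype.piFinset fun v => Finset.range (X v + 1)

/-- The real box `[0, X₁] × ⋯ × [0, Xₙ]`. -/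
def rbox {V : Type*} (X : V → ℕ) : Set (V → ℝ) :=
  {x | ∀ v, 0 ≤ x v ∧ x v ≤ X v}

namespace FactorGraphModel

variable {V C : Type*} [Fintype V] [Fintype C]

/-- The constraint vertices adjacent to the variable vertex `v`. -/
noncomputable def nbrV (F : FactorGraphModel V C) (v : V) : Finset C :=
  open Classical in Finset.univ.filter fun c => (v, c) ∈ F.E

/-- The variable vertices adjacent to the constraint vertex `c`. -/
noncomputable def nbrC (F : FactorGraphModel V C) (c : C) : Finset V :=
  open Classical in Finset.univ.filter fun v => (v, c) ∈ F.E

/-- Variable-to-constraint messages computed from the previous constraint-to-variable messages: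
`μ_{v→c}(β) = φ_v(β) + ∑_{c' ∈ N(v) \ {c}} μ_{c'→v}(β)`. -/
noncomputable def varUpdate (F : FactorGraphModel V C) (μ : C → V → ℕ → WithBot ℝ) :
    V → C → ℕ → WithBot ℝ :=
  open Classical in fun v c β =>
    ((F.φ v (β : ℝ) : ℝ) : WithBot ℝ) + ∑ c' ∈ (F.nbrV v).erase c, μ c' v β

/-- Constraint-to-variable messages computed from the current variable-to-constraint messages:
`μ_{c→v}(β)` is the maximum of `∑_{u ∈ N(c) \ {v}} μ_{u→c}(z_u)` over the `z` in the integral box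
with `z_v = β` and `ψ_c(z) = 0`; the maximum over the empty set is `-∞`. -/
noncomputable def conUpdate (F : FactorGraphModel V C) (ν : V → C → ℕ → WithBot ℝ) :
    C → V → ℕ → WithBot ℝ :=
  open Classical in fun c v β =>
    ((zbox F.X).filter fun z => z v = β ∧ F.ψ c z = 0).sup
      fun z => ∑ u ∈ (F.nbrC c).erase v, ν u c (z u)

/-- The constraint-to-variable messages `μ_{c→v}^{(t)}(β)` after `t` iterations, with the zero
initialization. -/
noncomputable def msgCV (F : FactorGraphModel V C) : ℕ → C → V → ℕ → WithBot ℝ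
  | 0 => fun _ _ _ => 0
  | t + 1 => F.conUpdate (F.varUpdate (F.msgCV t))

/-- The final value `μ_v(β)` after `t` iterations. -/
noncomputable def belief (F : FactorGraphModel V C) (t : ℕ) (v : V) (β : ℕ) : WithBot ℝ :=
  ((F.φ v (β : ℝ) : ℝ) : WithBot ℝ) + ∑ c ∈ F.nbrV v, F.msgCV t c v β

/-- `μ_v^max`, the maximum of `μ_v(β)` over the alphabet of `v`. -/
noncomputable def beliefMax (F : FactorGraphModel V C) (t : ℕ) (v : V) : WithBot ℝ :=
  (Finset.range (F.X v + 1)).sup (F.belief t v)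

/-- `δ_{v,t}`, the set of letters `β` of the alphabet of `v` with `μ_v(β) = μ_v^max`. -/
noncomputable def delta (F : FactorGraphModel V C) (t : ℕ) (v : V) : Finset ℕ :=
  open Classical in
    (Finset.range (F.X v + 1)).filter fun β => F.belief t v β = F.beliefMax t v

theorem delta_nonempty (F : FactorGraphModel V C) (t : ℕ) (v : V) : (F.delta t v).Nonempty := by
  obtain ⟨β, hβ, h⟩ := Finset.exists_mem_eq_sup (Finset.range (F.X v + 1))
    ⟨0, by simp⟩ (F.belief t v)
  exact ⟨β, Finset.mem_filter.2 ⟨hβ, h.symm⟩⟩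

/-- The output of the algorithm min-sum-packing with `t` iterations. -/
noncomputable def minSumPacking (F : FactorGraphModel V C) (t : ℕ) : V → ℕ := fun v =>
  if Even t then (F.delta t v).max' (F.delta_nonempty t v)
  else (F.delta t v).min' (F.delta_nonempty t v)

end FactorGraphModel

/-- The factor graph model of the packing problem with zero-one constraint matrix `A` (rows are
constraints, columns are variables), constraint vector `b`, weights `w` and boundary vector `X`. -/
noncomputable def packingModel {V C : Type*} [Fintype V] [Fintype C]
    (A : Matrix C V ℝ) (b : C → ℝ) (w : V → ℝ) (X : V → ℕ) : FactorGraphModel V C :=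
  open Classical in
  { E := Finset.univ.filter fun e => A e.2 e.1 = 1
    ψ := fun c y =>
      if ∑ v ∈ Finset.univ.filter (fun v => A c v = 1), (y v : ℝ) ≤ b c then 0 else ⊥
    φ := fun v β => w v * β
    X := X }

/-- The polytope `{x ∈ rbox X | A x ≤ b}`. -/
def packingPolytope {V C : Type*} [Fintype V]
    (A : Matrix C V ℝ) (b : C → ℝ) (X : V → ℕ) : Set (V → ℝ) :=
  {x | x ∈ rbox X ∧ ∀ c, (A.mulVec x) c ≤ b c}

/-- `argmax {wᵀ x | x ∈ P}`, the set of optimal solutions. -/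
def optSet {V : Type*} [Fintype V] (P : Set (V → ℝ)) (w : V → ℝ) : Set (V → ℝ) :=
  {x | x ∈ P ∧ ∀ y ∈ P, w ⬝ᵥ y ≤ w ⬝ᵥ x}

/-- `c(P, w)`: the minimum of `wᵀ (x* - x) / ‖x* - x‖₁` over `x ∈ P \ {x*}`, where `xs` is the
optimal solution `x*`. For `P = {x*}` the value is `0`; the quotient `w_max / c(P, w)` is then `0`,
as it is for the convention that a minimum over the empty set is `+∞`. -/
noncomputable def cGap {V : Type*} [Fintype V] (P : Set (V → ℝ)) (w xs : V → ℝ) : ℝ :=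
  sInf ((fun x => (w ⬝ᵥ (xs - x)) / ∑ i, |xs i - x i|) '' (P \ {xs}))

/-- `w_max`, the largest weight (the value on an empty index set is irrelevant). -/
noncomputable def wMax {V : Type*} (w : V → ℝ) : ℝ := ⨆ i, w i

end MinSumPacking

/-! A letter β ≠ x*_v of finite belief never maximizes μ_v: the letter one step closer to x*_v has a
strictly larger belief. So x*_v is the only maximizer, and the tie-breaking rule plays no role.

To compare the two beliefs, take an assignment of the computation tree that realizes the belief of β
and move its root by one towards x*. Each constraint touched by the move either stays satisfied or
is repaired by moving one other of its variables towards x*, with opposite effect on the load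
(`con_exchange`). Columns have at most two ones, so the repairs form a path through the root with at
most two ends.

Folded back to the original variables, the removed deviation y is a feasible direction at x*, so wᵀy
≤ -c‖y‖₁ (`dotProduct_le_of_mem_feasibleCone`). All moves go towards x*, so nothing cancels and ‖y‖₁
counts the moved tree vertices in y. Only a move at a leaf may have to be left out of y, at a cost
of at most w_max. If e ≤ 2 ends are left out and t ≥ 1, then ‖y‖₁ ≥ 1 + e(t - 1), and e·w_max - c(1
+ e(t - 1)) < 0 by the assumption on t (`belief_lt_belief_shift`). -/

namespace MinSumPacking

open Filter Topology

/-! ### Feasible directions at x* and the gap constant. -/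

section Geometry

variable {V C : Type*} [Fintype V]

/-- The cone of feasible directions of the packing polytope at the point `xs`. -/
def feasibleCone (A : Matrix C V ℝ) (b : C → ℝ) (X : V → ℕ) (xs : V → ℝ) : Set (V → ℝ) :=
  {d | (∀ v, (xs v = 0 → 0 ≤ d v) ∧ (xs v = X v → d v ≤ 0)) ∧
    ∀ c, A.mulVec xs c = b c → A.mulVec d c ≤ 0}

theorem eventually_add_mul_le {a d r : ℝ} (h : a ≤ r) (h' : a = r → d ≤ 0) :
    ∀ᶠ ε in 𝓝[>] (0 : ℝ), a + ε * d ≤ r := by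
  rcases h.eq_or_lt with h | h
  · filter_upwards [self_mem_nhdsWithin] with ε hε
    have := mul_nonpos_of_nonneg_of_nonpos (le_of_lt hε) (h' h)
    linarith
  · have : Tendsto (fun ε : ℝ => a + ε * d) (𝓝[>] 0) (𝓝 (a + 0 * d)) :=
      ((continuous_const.add (continuous_id.mul continuous_const)).tendsto 0).mono_left
        nhdsWithin_le_nhds
    rw [zero_mul, add_zero] at this
    exact (this.eventually (gt_mem_nhds h)).mono fun _ => le_of_lt

theorem exists_pos_add_smul_mem [Finite C] {A : Matrix C V ℝ} {b : C → ℝ} {X : V → ℕ} {xs d : V → ℝ}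
    (hx : xs ∈ packingPolytope A b X) (hd : d ∈ feasibleCone A b X xs) :
    ∃ ε : ℝ, 0 < ε ∧ xs + ε • d ∈ packingPolytope A b X := by
  have h1 : ∀ᶠ ε in 𝓝[>] (0 : ℝ), ∀ v, xs v + ε * d v ≤ X v :=
    eventually_all.2 fun v => eventually_add_mul_le (hx.1 v).2 (hd.1 v).2
  have h2 : ∀ᶠ ε in 𝓝[>] (0 : ℝ), ∀ v, -xs v + ε * -d v ≤ 0 :=
    eventually_all.2 fun v => eventually_add_mul_le (by linarith [(hx.1 v).1])
      fun h => by linarith [(hd.1 v).1 (by linarith)]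
  have h3 : ∀ᶠ ε in 𝓝[>] (0 : ℝ), ∀ c, A.mulVec xs c + ε * A.mulVec d c ≤ b c :=
    eventually_all.2 fun c => eventually_add_mul_le (hx.2 c) (hd.2 c)
  obtain ⟨ε, ⟨⟨h1, h2⟩, h3⟩, hε⟩ := (((h1.and h2).and h3).and self_mem_nhdsWithin).exists
  refine ⟨ε, hε, fun v => ⟨?_, ?_⟩, fun c => ?_⟩
  · have := h2 v
    simp only [Pi.add_apply, Pi.smul_apply, smul_eq_mul]
    linarith
  · simpa using h1 v
  · simpa [Matrix.mulVec_add, Matrix.mulVec_smul] using h3 c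

variable {A : Matrix C V ℝ} {b : C → ℝ} {X : V → ℕ} {w xs : V → ℝ}

theorem dotProduct_lt_of_optSet {P : Set (V → ℝ)} (hopt : optSet P w = {xs}) {x : V → ℝ}
    (hx : x ∈ P) (hne : x ≠ xs) : w ⬝ᵥ x < w ⬝ᵥ xs := by
  have hxs : xs ∈ optSet P w := by rw [hopt]; rfl
  refine lt_of_le_of_ne (hxs.2 x hx) fun h => hne ?_
  have : x ∈ optSet P w := ⟨hx, fun y hy => h ▸ hxs.2 y hy⟩
  rw [hopt] at this
  exact this

theorem dotProduct_neg_of_mem_feasibleCone [Finite C]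
    (hopt : optSet (packingPolytope A b X) w = {xs})
    {d : V → ℝ} (hd : d ∈ feasibleCone A b X xs) (hne : d ≠ 0) : w ⬝ᵥ d < 0 := by
  have hxs : xs ∈ optSet (packingPolytope A b X) w := by rw [hopt]; rfl
  obtain ⟨ε, hε, h⟩ := exists_pos_add_smul_mem hxs.1 hd
  have := dotProduct_lt_of_optSet hopt h (by simp [hε.ne', hne])
  rw [dotProduct_add, dotProduct_smul, smul_eq_mul] at this
  by_contra hcon
  nlinarith [mul_nonneg hε.le (not_lt.1 hcon)]

theorem sum_abs_pos {d : V → ℝ} (hne : d ≠ 0) : 0 < ∑ i, |d i| := by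
  obtain ⟨i, hi⟩ := Function.ne_iff.1 hne
  exact Finset.sum_pos' (fun _ _ => abs_nonneg _) ⟨i, Finset.mem_univ _, abs_pos.2 hi⟩

theorem isClosed_feasibleCone : IsClosed (feasibleCone A b X xs) := by
  have : feasibleCone A b X xs = (⋂ v, ⋂ _ : xs v = 0, {d | 0 ≤ d v}) ∩
      (⋂ v, ⋂ _ : xs v = X v, {d | d v ≤ 0}) ∩
      ⋂ c, ⋂ _ : A.mulVec xs c = b c, {d | A.mulVec d c ≤ 0} := by
    ext d
    simp [feasibleCone, forall_and]
  rw [this]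
  refine ((isClosed_iInter fun v => isClosed_iInter fun _ => ?_).inter
    (isClosed_iInter fun v => isClosed_iInter fun _ => ?_)).inter
    (isClosed_iInter fun c => isClosed_iInter fun _ => ?_)
  · exact isClosed_le continuous_const (continuous_apply v)
  · exact isClosed_le (continuous_apply v) continuous_const
  · refine isClosed_le ?_ continuous_const
    simp only [Matrix.mulVec, dotProduct]
    fun_prop

theorem smul_sub_mem_feasibleCone {x : V → ℝ} (hx : x ∈ packingPolytope A b X) {r : ℝ}
    (hr : 0 ≤ r) : r • (x - xs) ∈ feasibleCone A b X xs := by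
  refine ⟨fun v => ⟨fun h => ?_, fun h => ?_⟩, fun c h => ?_⟩
  · simpa [h] using mul_nonneg hr (hx.1 v).1
  · simpa [h] using mul_nonpos_of_nonneg_of_nonpos hr (sub_nonpos.2 (hx.1 v).2)
  · simpa [Matrix.mulVec_smul, Matrix.mulVec_sub, h] using
      mul_nonpos_of_nonneg_of_nonpos hr (sub_nonpos.2 (hx.2 c))

theorem cGap_nonneg (hopt : optSet (packingPolytope A b X) w = {xs}) :
    0 ≤ cGap (packingPolytope A b X) w xs := by
  refine Real.sInf_nonneg ?_
  rintro _ ⟨x, hx, rfl⟩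
  have := dotProduct_lt_of_optSet hopt hx.1 hx.2
  refine div_nonneg ?_ (Finset.sum_nonneg fun _ _ => abs_nonneg _)
  rw [dotProduct_sub]
  linarith

/-- The infimum could be approached near x*, but the ratio depends only on the direction x - x*. The
normalized feasible directions form a compact set, on which wᵀd attains a negative maximum. -/
theorem cGap_pos [Finite C]
    (hopt : optSet (packingPolytope A b X) w = {xs})
    (hne : (packingPolytope A b X \ {xs}).Nonempty) :
    0 < cGap (packingPolytope A b X) w xs := by
  set S : Set (V → ℝ) := feasibleCone A b X xs ∩ {d | ∑ i, |d i| = 1}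
  have normalize : ∀ x ∈ packingPolytope A b X \ {xs},
      (∑ i, |xs i - x i|)⁻¹ • (x - xs) ∈ S ∧ 0 < ∑ i, |xs i - x i| := by
    intro x hx
    have hpos : 0 < ∑ i, |xs i - x i| := sum_abs_pos (d := xs - x) (sub_ne_zero.2 (Ne.symm hx.2))
    refine ⟨⟨smul_sub_mem_feasibleCone hx.1 (inv_nonneg.2 hpos.le), ?_⟩, hpos⟩
    simp only [Set.mem_ofPred_eq, Pi.smul_apply, smul_eq_mul, abs_mul, Pi.sub_apply,
      abs_of_pos (inv_pos.2 hpos), ← Finset.mul_sum]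
    simp_rw [abs_sub_comm (x _)]
    exact inv_mul_cancel₀ hpos.ne'
  have hcl : IsClosed S :=
    isClosed_feasibleCone.inter (isClosed_eq (by fun_prop) continuous_const)
  have hcomp : IsCompact S := by
    refine (isCompact_univ_pi fun _ : V => isCompact_Icc (a := (-1 : ℝ)) (b := 1)).of_isClosed_subset
      hcl fun d hd i _ => abs_le.1 ?_
    exact (Finset.single_le_sum (f := fun i => |d i|) (fun _ _ => abs_nonneg _)
      (Finset.mem_univ i)).trans hd.2.le
  obtain ⟨x₀, hx₀⟩ := hne
  obtain ⟨d, hd, hmax⟩ := hcomp.exists_isMaxOn ⟨_, (normalize x₀ hx₀).1⟩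
    (f := fun d => w ⬝ᵥ d) (by simp only [dotProduct]; fun_prop)
  have hneg : w ⬝ᵥ d < 0 := by
    refine dotProduct_neg_of_mem_feasibleCone hopt hd.1 ?_
    rintro rfl
    simpa using hd.2
  refine lt_of_lt_of_le (neg_pos.2 hneg) (le_csInf ⟨_, x₀, hx₀, rfl⟩ ?_)
  rintro _ ⟨x, hx, rfl⟩
  have h := hmax (normalize x hx).1
  simp only [Set.mem_ofPred_eq, dotProduct_smul, smul_eq_mul, dotProduct_sub] at h
  change -(w ⬝ᵥ d) ≤ (w ⬝ᵥ (xs - x)) / _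
  rw [dotProduct_sub, div_eq_inv_mul]
  linarith

/-- The ratio in `cGap` is invariant under scaling, so its bound at x* + εd passes to d. A nonzero d
also yields a second point of the polytope, which excludes the conventional value 0. -/
theorem dotProduct_le_of_mem_feasibleCone [Finite C]
    (hopt : optSet (packingPolytope A b X) w = {xs})
    {d : V → ℝ} (hd : d ∈ feasibleCone A b X xs) (hne : d ≠ 0) :
    0 < cGap (packingPolytope A b X) w xs ∧
      w ⬝ᵥ d ≤ -(cGap (packingPolytope A b X) w xs * ∑ i, |d i|) := by
  have hxs : xs ∈ optSet (packingPolytope A b X) w := by rw [hopt]; rfl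
  obtain ⟨ε, hε, h⟩ := exists_pos_add_smul_mem hxs.1 hd
  have hmem : xs + ε • d ∈ packingPolytope A b X \ {xs} := ⟨h, by simp [hε.ne', hne]⟩
  refine ⟨cGap_pos hopt ⟨_, hmem⟩, ?_⟩
  have hle : cGap (packingPolytope A b X) w xs ≤
      (w ⬝ᵥ (xs - (xs + ε • d))) / ∑ i, |xs i - (xs + ε • d) i| := by
    refine csInf_le ⟨0, ?_⟩ ⟨_, hmem, rfl⟩
    rintro _ ⟨x, hx, rfl⟩
    have := dotProduct_lt_of_optSet hopt hx.1 hx.2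
    refine div_nonneg ?_ (Finset.sum_nonneg fun _ _ => abs_nonneg _)
    rw [dotProduct_sub]
    linarith
  have hpos := sum_abs_pos hne
  have hsum : ∑ i, |xs i - (xs + ε • d) i| = ε * ∑ i, |d i| := by
    simp [abs_mul, abs_of_pos hε, Finset.mul_sum]
  have hdot : w ⬝ᵥ (xs - (xs + ε • d)) = ε * -(w ⬝ᵥ d) := by
    rw [sub_add_cancel_left, dotProduct_neg, dotProduct_smul, smul_eq_mul, mul_neg]
  rw [hsum, hdot, mul_div_mul_left _ _ hε.ne', le_div_iff₀ hpos] at hle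
  linarith

end Geometry

open FactorGraphModel

/-! ### Moves towards x*, their loads, and the message updates. -/

section Messages

variable {V C : Type*}

/-- The direction in which a coordinate may leave the extreme point `xs`. -/
noncomputable def inwardSign (xs : V → ℝ) (v : V) : ℝ := if xs v = 0 then 1 else -1

/-- The letter of the alphabet of `v` that represents `xs v`. -/
noncomputable def extremeLetter (X : V → ℕ) (xs : V → ℝ) (v : V) : ℕ := if xs v = 0 then 0 else X v

/-- Move a letter of the alphabet of `v` by one towards `xs v`. -/
noncomputable def shift (xs : V → ℝ) (v : V) (β : ℕ) : ℕ := if xs v = 0 then β - 1 else β + 1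

variable {X : V → ℕ} {xs : V → ℝ}

theorem cast_extremeLetter (hxs : ∀ i, xs i = 0 ∨ xs i = (X i : ℝ)) (v : V) :
    (extremeLetter X xs v : ℝ) = xs v := by
  unfold extremeLetter
  split_ifs with h
  · simp [h]
  · exact ((hxs v).resolve_left h).symm

theorem extremeLetter_le (v : V) : extremeLetter X xs v ≤ X v := by
  unfold extremeLetter
  split_ifs <;> simp

theorem inwardSign_mul_self (v : V) : inwardSign xs v * inwardSign xs v = 1 := by
  unfold inwardSign
  split_ifs <;> norm_num

theorem shift_le {v : V} {β : ℕ} (h : β ≤ X v) (h' : β ≠ extremeLetter X xs v) :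
    shift xs v β ≤ X v := by
  unfold shift extremeLetter at *
  split_ifs at * <;> omega

theorem cast_shift {v : V} {β : ℕ} (h' : β ≠ extremeLetter X xs v) :
    (shift xs v β : ℝ) = β - inwardSign xs v := by
  unfold shift extremeLetter inwardSign at *
  split_ifs at *
  · rw [Nat.cast_sub (by omega), Nat.cast_one]
  · push_cast
    ring

variable [Fintype V]

/-- The direction `y` moves every coordinate inward, and moves the load of each constraint that is
tight at `xs` by at most `q`. -/
structure IsInward (A : Matrix C V ℝ) (b : C → ℝ) (X : V → ℕ) (xs y : V → ℝ) (q : C → ℝ) :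
    Prop where
  sign : ∀ v, 0 ≤ inwardSign xs v * y v
  supp : ∀ v, X v = 0 → y v = 0
  load : ∀ c, A.mulVec xs c = b c → A.mulVec y c ≤ q c

variable {A : Matrix C V ℝ} {b : C → ℝ} {w : V → ℝ}

theorem IsInward.mem_feasibleCone {y : V → ℝ}
    (h : IsInward A b X xs y 0) : y ∈ feasibleCone A b X xs := by
  refine ⟨fun v => ⟨fun hv => ?_, fun hv => ?_⟩, h.load⟩
  · simpa [inwardSign, hv] using h.sign v
  -- If xs v = X v = 0, both bounds are active while the inward sign is 1; only `supp` gives d v ≤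
  -- 0.
  · by_cases h0 : xs v = 0
    · exact (h.supp v (by exact_mod_cast hv.symm.trans h0)).le
    · simpa [inwardSign, h0] using h.sign v

theorem IsInward.sum_abs {y : V → ℝ} {q : C → ℝ} (h : IsInward A b X xs y q) :
    ∑ v, |y v| = ∑ v, inwardSign xs v * y v := by
  refine Finset.sum_congr rfl fun v _ => ?_
  rw [← abs_of_nonneg (h.sign v), abs_mul]
  unfold inwardSign
  split_ifs <;> simp

theorem isInward_zero {q : C → ℝ} (h : ∀ c, A.mulVec xs c = b c → 0 ≤ q c) :
    IsInward A b X xs 0 q :=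
  ⟨by simp, by simp, by simpa using h⟩

theorem isInward_single [DecidableEq V] {v : V} (hX : X v ≠ 0) {q : C → ℝ}
    (h : ∀ c, A.mulVec xs c = b c → A c v * inwardSign xs v ≤ q c) :
    IsInward A b X xs (Pi.single v (inwardSign xs v)) q := by
  refine ⟨fun u => ?_, fun u hu => ?_, fun c hc => ?_⟩
  · rcases eq_or_ne u v with rfl | hu
    · simp [inwardSign_mul_self]
    · simp [hu]
  · rw [Pi.single_eq_of_ne]
    rintro rfl
    exact hX hu
  · simpa using h c hc

theorem IsInward.add {y z : V → ℝ} {q r : C → ℝ} (hy : IsInward A b X xs y q)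
    (hz : IsInward A b X xs z r) : IsInward A b X xs (y + z) (q + r) := by
  refine ⟨fun v => ?_, fun v hv => ?_, fun c hc => ?_⟩
  · rw [Pi.add_apply, mul_add]
    exact add_nonneg (hy.sign v) (hz.sign v)
  · simp [hy.supp v hv, hz.supp v hv]
  · rw [Matrix.mulVec_add]
    exact add_le_add (hy.load c hc) (hz.load c hc)

theorem IsInward.sum {ι : Type*} (s : Finset ι) {y : ι → V → ℝ} {q : ι → C → ℝ}
    (h : ∀ i ∈ s, IsInward A b X xs (y i) (q i)) :
    IsInward A b X xs (∑ i ∈ s, y i) (∑ i ∈ s, q i) := by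
  classical
  induction s using Finset.induction_on with
  | empty => exact isInward_zero (by simp)
  | insert i s hi ih =>
    rw [Finset.sum_insert hi, Finset.sum_insert hi]
    exact (h i (by simp)).add (ih fun j hj => h j (by simp [hj]))

theorem IsInward.mono {y : V → ℝ} {q r : C → ℝ} (h : IsInward A b X xs y q)
    (hqr : ∀ c, q c ≤ r c) : IsInward A b X xs y r :=
  ⟨h.sign, h.supp, fun c hc => (h.load c hc).trans (hqr c)⟩

/-- Shifting a letter towards `xs` changes a message from `p` to at least `p - (wᵀ y + e ω)`, where
`y` is an inward direction and `e` counts the coordinates at the boundary of the computation that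
are left out of `y`; each of them accounts for at least `t` coordinates of `y`. -/
structure Exchange (A : Matrix C V ℝ) (b : C → ℝ) (w : V → ℝ) (X : V → ℕ) (xs : V → ℝ) (ω t : ℝ)
    (q : C → ℝ) (p p' : WithBot ℝ) (y : V → ℝ) (e : ℝ) : Prop where
  inward : IsInward A b X xs y q
  nonneg : 0 ≤ e
  le_one : e ≤ 1
  length : e * t ≤ ∑ v, inwardSign xs v * y v
  value : p ≤ p' + ((w ⬝ᵥ y + e * ω : ℝ) : WithBot ℝ)

theorem withBot_coe_sum {ι : Type*} (s : Finset ι) (f : ι → ℝ) :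
    ((∑ i ∈ s, f i : ℝ) : WithBot ℝ) = ∑ i ∈ s, (f i : WithBot ℝ) := by
  classical
  induction s using Finset.induction_on with
  | empty => simp
  | insert i s hi ih => simp [Finset.sum_insert hi, ih]

theorem withBot_ne_bot_of_sum {ι : Type*} {s : Finset ι} {f : ι → WithBot ℝ}
    (h : ∑ i ∈ s, f i ≠ ⊥) {i : ι} (hi : i ∈ s) : f i ≠ ⊥ := by
  classical
  intro hbot
  rw [← Finset.add_sum_erase s f hi, hbot, WithBot.bot_add] at h
  exact h rfl

theorem withBot_sum_ne_bot {ι : Type*} {s : Finset ι} {f : ι → WithBot ℝ}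
    (h : ∀ i ∈ s, f i ≠ ⊥) : ∑ i ∈ s, f i ≠ ⊥ := by
  classical
  induction s using Finset.induction_on with
  | empty => simp
  | insert i s hi ih =>
    rw [Finset.sum_insert hi]
    simp only [ne_eq, WithBot.add_eq_bot, not_or]
    exact ⟨h i (by simp), ih fun j hj => h j (by simp [hj])⟩

/-- At each constraint in S the load of the unit move of v cancels against the bound of the branch
behind it, so v only loads its constraints outside S. The 1 in the length is v itself. -/
theorem node_exchange [DecidableEq C] [DecidableEq V] {S : Finset C} {v : V} {ω t : ℝ}
    {g : C → ℕ → WithBot ℝ} {β : ℕ} (hβ : β ≤ X v) (hβ' : β ≠ extremeLetter X xs v)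
    (h : ∀ c ∈ S, ∃ y e, Exchange A b w X xs ω t (Pi.single c (-inwardSign xs v)) (g c β)
      (g c (shift xs v β)) y e) :
    ∃ (y : V → ℝ) (e : ℝ), IsInward A b X xs y
        (fun c => A c v * inwardSign xs v - if c ∈ S then inwardSign xs v else 0) ∧
      0 ≤ e ∧ e ≤ S.card ∧ 1 + e * t ≤ ∑ u, inwardSign xs u * y u ∧
      ((w v * β : ℝ) : WithBot ℝ) + ∑ c ∈ S, g c β ≤
        ((w v * (shift xs v β : ℕ) : ℝ) : WithBot ℝ) + ∑ c ∈ S, g c (shift xs v β) +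
          ((w ⬝ᵥ y + e * ω : ℝ) : WithBot ℝ) := by
  choose! y e h using h
  have hX : X v ≠ 0 := by
    have := extremeLetter_le (X := X) (xs := xs) v
    omega
  refine ⟨Pi.single v (inwardSign xs v) + ∑ c ∈ S, y c, ∑ c ∈ S, e c, ?_,
    Finset.sum_nonneg fun c hc => (h c hc).nonneg, ?_, ?_, ?_⟩
  · refine ((isInward_single hX (q := fun c => A c v * inwardSign xs v) fun _ _ => le_rfl).add
      (IsInward.sum S fun c hc => (h c hc).inward)).mono fun c => le_of_eq ?_
    rw [Pi.add_apply, Finset.sum_apply, Finset.sum_pi_single]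
    split_ifs <;> ring
  · have := Finset.sum_le_sum fun c hc => (h c hc).le_one
    refine this.trans ?_
    simp
  · have : ∑ u, inwardSign xs u * (Pi.single v (inwardSign xs v) + ∑ c ∈ S, y c : V → ℝ) u =
        1 + ∑ c ∈ S, ∑ u, inwardSign xs u * y c u := by
      simp only [Pi.add_apply, mul_add, Finset.sum_add_distrib, Finset.sum_apply, Finset.mul_sum]
      rw [Finset.sum_comm]
      congr 1
      simp [Pi.single_apply, inwardSign_mul_self]
    rw [this, Finset.sum_mul]
    gcongr with c hc
    exact (h c hc).length
  · have hy : w ⬝ᵥ (Pi.single v (inwardSign xs v) + ∑ c ∈ S, y c) + (∑ c ∈ S, e c) * ω =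
        w v * inwardSign xs v + ∑ c ∈ S, (w ⬝ᵥ y c + e c * ω) := by
      rw [dotProduct_add, dotProduct_single, dotProduct_sum, Finset.sum_add_distrib,
        Finset.sum_mul, add_assoc]
    have hw : w v * (β : ℝ) = w v * (shift xs v β : ℕ) + w v * inwardSign xs v := by
      rw [cast_shift hβ']
      ring
    calc ((w v * β : ℝ) : WithBot ℝ) + ∑ c ∈ S, g c β
        ≤ ((w v * β : ℝ) : WithBot ℝ) +
          ∑ c ∈ S, (g c (shift xs v β) + ((w ⬝ᵥ y c + e c * ω : ℝ) : WithBot ℝ)) := by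
          gcongr with c hc
          exact (h c hc).value
      _ = _ := by
        rw [hy, hw, Finset.sum_add_distrib, ← withBot_coe_sum, WithBot.coe_add, WithBot.coe_add]
        abel

variable [Fintype C]

theorem mem_nbrV {c : C} {v : V} : c ∈ (packingModel A b w X).nbrV v ↔ A c v = 1 := by
  simp [nbrV, packingModel]

theorem mem_nbrC {c : C} {v : V} : v ∈ (packingModel A b w X).nbrC c ↔ A c v = 1 := by
  simp [nbrC, packingModel]

theorem mem_zbox {z : V → ℕ} : z ∈ zbox X ↔ ∀ v, z v ≤ X v := by
  simp [zbox]

theorem mulVec_eq_sum (hA : ∀ j i, A j i = 0 ∨ A j i = 1) (c : C) (x : V → ℝ) :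
    A.mulVec x c = ∑ u ∈ (packingModel A b w X).nbrC c, x u := by
  classical
  rw [Matrix.mulVec, dotProduct, ← Finset.sum_subset (Finset.subset_univ
    ((packingModel A b w X).nbrC c))]
  · refine Finset.sum_congr rfl fun u hu => ?_
    rw [mem_nbrC.1 hu, one_mul]
  · intro u _ hu
    rw [mem_nbrC] at hu
    rw [(hA c u).resolve_right hu, zero_mul]

theorem ψ_eq_zero_iff {c : C} {z : V → ℕ} :
    (packingModel A b w X).ψ c z = 0 ↔
      ∑ u ∈ (packingModel A b w X).nbrC c, (z u : ℝ) ≤ b c := by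
  classical
  have : (packingModel A b w X).nbrC c = Finset.univ.filter fun v => A c v = 1 := by
    ext u
    simp [mem_nbrC]
  rw [this]
  simp only [packingModel]
  split_ifs with h
  · exact ⟨fun _ => by convert h, fun _ => rfl⟩
  · refine ⟨fun h0 => by simp at h0, fun h' => absurd (by convert h') h⟩

open Classical in
theorem le_conUpdate {ν : V → C → ℕ → WithBot ℝ} {c : C} {v : V} {z : V → ℕ}
    (hz : ∀ u, z u ≤ X u)
    (hb : ∑ u ∈ (packingModel A b w X).nbrC c, (z u : ℝ) ≤ b c) :
    ∑ u ∈ ((packingModel A b w X).nbrC c).erase v, ν u c (z u) ≤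
      (packingModel A b w X).conUpdate ν c v (z v) :=
  Finset.le_sup (f := fun z : V → ℕ =>
    ∑ u ∈ ((packingModel A b w X).nbrC c).erase v, ν u c (z u))
    (Finset.mem_filter.2 ⟨mem_zbox.2 hz, rfl, ψ_eq_zero_iff.2 hb⟩)

open Classical in
theorem exists_conUpdate_eq {ν : V → C → ℕ → WithBot ℝ} {c : C} {v : V} {β : ℕ}
    (h : (packingModel A b w X).conUpdate ν c v β ≠ ⊥) :
    ∃ z : V → ℕ, (∀ u, z u ≤ X u) ∧ z v = β ∧
      ∑ u ∈ (packingModel A b w X).nbrC c, (z u : ℝ) ≤ b c ∧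
      (packingModel A b w X).conUpdate ν c v β =
        ∑ u ∈ ((packingModel A b w X).nbrC c).erase v, ν u c (z u) := by
  have hne : ((zbox X).filter fun z => z v = β ∧ (packingModel A b w X).ψ c z = 0).Nonempty := by
    refine Finset.nonempty_iff_ne_empty.2 fun he => h ?_
    unfold conUpdate
    exact (congrArg (fun s => Finset.sup s _) he).trans Finset.sup_empty
  obtain ⟨z, hz, hsup⟩ := Finset.exists_mem_eq_sup _ hne
    fun z : V → ℕ => ∑ u ∈ ((packingModel A b w X).nbrC c).erase v, ν u c (z u)
  rw [Finset.mem_filter] at hz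
  exact ⟨z, mem_zbox.1 hz.1, hz.2.1, ψ_eq_zero_iff.1 hz.2.2, hsup⟩

end Messages

/-! ### Exchanges along the computation tree. -/

section Exchange

variable {V C : Type*} {X : V → ℕ} {xs : V → ℝ}

theorem inwardSign_eq_or (v : V) : inwardSign xs v = 1 ∨ inwardSign xs v = -1 := by
  unfold inwardSign
  split_ifs <;> simp

theorem extremeLetter_add_one_le {v : V} (hv : inwardSign xs v = 1) {β : ℕ}
    (hβ : β ≠ extremeLetter X xs v) : extremeLetter X xs v + 1 ≤ β := by
  unfold inwardSign extremeLetter at *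
  split_ifs at *
  · omega
  · norm_num at hv

theorem add_one_le_extremeLetter {v : V} (hv : inwardSign xs v = -1) {β : ℕ} (hβX : β ≤ X v)
    (hβ : β ≠ extremeLetter X xs v) : β + 1 ≤ extremeLetter X xs v := by
  unfold inwardSign extremeLetter at *
  split_ifs at *
  · norm_num at hv
  · omega

theorem extremeLetter_le_of_inwardSign {v : V} {β : ℕ}
    (h : inwardSign xs v = -1 → β = extremeLetter X xs v) : extremeLetter X xs v ≤ β := by
  rcases inwardSign_eq_or (xs := xs) v with hv | hv
  · by_cases hβ : β = extremeLetter X xs v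
    · exact hβ.ge
    · exact (Nat.le_succ _).trans (extremeLetter_add_one_le hv hβ)
  · exact (h hv).ge

theorem le_extremeLetter_of_inwardSign {v : V} {β : ℕ} (hβX : β ≤ X v)
    (h : inwardSign xs v = 1 → β = extremeLetter X xs v) : β ≤ extremeLetter X xs v := by
  rcases inwardSign_eq_or (xs := xs) v with hv | hv
  · exact (h hv).le
  · by_cases hβ : β = extremeLetter X xs v
    · exact hβ.le
    · exact (Nat.le_succ _).trans (add_one_le_extremeLetter hv hβX hβ)

open Classical in
theorem cast_update_shift {z : V → ℕ} {v : V} (h : z v ≠ extremeLetter X xs v) (u : V) :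
    (Function.update z v (shift xs v (z v)) u : ℝ) =
      z u - if u = v then inwardSign xs v else 0 := by
  rcases eq_or_ne u v with rfl | hu
  · simp [cast_shift h]
  · simp [hu]

theorem update_shift_le [DecidableEq V] {z : V → ℕ} {v : V} (hz : ∀ u, z u ≤ X u)
    (h : z v ≠ extremeLetter X xs v) (u : V) :
    Function.update z v (shift xs v (z v)) u ≤ X u := by
  rcases eq_or_ne u v with rfl | hu
  · simpa using shift_le (hz u) h
  · simpa [hu] using hz u

variable [Fintype V] [Fintype C] {A : Matrix C V ℝ} {b : C → ℝ} {w : V → ℝ}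

-- Start from a maximizer z and shift z_v. If another variable of c is off x* with opposite inward
-- sign, shifting it as well restores the load of c, and its own message supplies the exchange.
-- Otherwise no repair is needed and the path ends with y = 0, e = 0.
open Classical in
theorem con_exchange (hA : ∀ j i, A j i = 0 ∨ A j i = 1) (hxs : ∀ i, xs i = 0 ∨ xs i = (X i : ℝ))
    (hmem : xs ∈ packingPolytope A b X) {ν : V → C → ℕ → WithBot ℝ} {ω t : ℝ} {c : C}
    (hν : ∀ u β, A c u = 1 → β ≤ X u → β ≠ extremeLetter X xs u → ν u c β ≠ ⊥ →
      ∃ y e, Exchange A b w X xs ω t (Pi.single c (inwardSign xs u)) (ν u c β)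
        (ν u c (shift xs u β)) y e)
    {v : V} {β : ℕ} (hcv : A c v = 1) (hβ' : β ≠ extremeLetter X xs v)
    (hbot : (packingModel A b w X).conUpdate ν c v β ≠ ⊥) :
    ∃ y e, Exchange A b w X xs ω t (Pi.single c (-inwardSign xs v))
      ((packingModel A b w X).conUpdate ν c v β)
      ((packingModel A b w X).conUpdate ν c v (shift xs v β)) y e := by
  obtain ⟨z, hzX, rfl, hzb, hval⟩ := exists_conUpdate_eq hbot
  rw [hval] at hbot ⊢
  set N := (packingModel A b w X).nbrC c
  have hvN : v ∈ N := mem_nbrC.2 hcv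
  set z₁ := Function.update z v (shift xs v (z v)) with hz₁
  have hz₁X : ∀ u, z₁ u ≤ X u := update_shift_le hzX hβ'
  have hz₁v : z₁ v = shift xs v (z v) := by simp [hz₁]
  have hz₁ne : ∀ u, u ≠ v → z₁ u = z u := fun u hu => by simp [hz₁, hu]
  have hsum₁ : ∑ u ∈ N, (z₁ u : ℝ) = ∑ u ∈ N, (z u : ℝ) - inwardSign xs v := by
    simp_rw [hz₁, cast_update_shift hβ', Finset.sum_sub_distrib]
    simp [hvN]
  by_cases hch : ∃ u ∈ N, u ≠ v ∧ inwardSign xs u = -inwardSign xs v ∧ z u ≠ extremeLetter X xs u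
  · obtain ⟨u, huN, huv, hsu, hzu⟩ := hch
    have huE : u ∈ N.erase v := Finset.mem_erase.2 ⟨huv, huN⟩
    obtain ⟨y, e, h⟩ := hν u (z u) (mem_nbrC.1 huN) (hzX u) hzu (withBot_ne_bot_of_sum hbot huE)
    have hz₁u := hz₁ne u huv
    have hzu₁ : z₁ u ≠ extremeLetter X xs u := by rwa [hz₁u]
    set z₂ := Function.update z₁ u (shift xs u (z₁ u)) with hz₂
    have hz₂v : z₂ v = shift xs v (z v) := by simp [hz₂, huv.symm, hz₁v]
    have hsum₂ : ∑ x ∈ N, (z₂ x : ℝ) ≤ b c := by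
      have : ∑ x ∈ N, (z₂ x : ℝ) = ∑ x ∈ N, (z₁ x : ℝ) - inwardSign xs u := by
        simp_rw [hz₂, cast_update_shift hzu₁, Finset.sum_sub_distrib]
        simp [huN]
      rw [this, hsum₁, hsu]
      linarith
    have hle := le_conUpdate (w := w) (ν := ν) (v := v) (z := z₂) (update_shift_le hz₁X hzu₁) hsum₂
    rw [hz₂v] at hle
    refine ⟨y, e, ?_, h.nonneg, h.le_one, h.length, ?_⟩
    · rw [← hsu]
      exact h.inward
    · refine le_trans ?_ (add_le_add_left hle _)
      rw [← Finset.add_sum_erase _ _ huE, ← Finset.add_sum_erase _ (fun x => ν x c (z₂ x)) huE,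
        add_right_comm]
      refine add_le_add ?_ (Finset.sum_le_sum fun x hx => ?_)
      · have : z₂ u = shift xs u (z u) := by simp [hz₂, hz₁u]
        rw [this]
        exact h.value
      · have hxu := (Finset.mem_erase.1 hx).1
        have hxv := (Finset.mem_erase.1 (Finset.mem_erase.1 hx).2).1
        have : z₂ x = z x := by simp [hz₂, hxu, hz₁ne x hxv]
        rw [this]
  · push Not at hch
    have hxsum : ∑ u ∈ N, (extremeLetter X xs u : ℝ) = A.mulVec xs c := by
      rw [mulVec_eq_sum (b := b) (w := w) (X := X) hA]
      exact Finset.sum_congr rfl fun u _ => cast_extremeLetter hxs u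
    have hmemc := hmem.2 c
    suffices h : ∑ u ∈ N, (z₁ u : ℝ) ≤ b c ∧
        (A.mulVec xs c = b c → 0 ≤ -inwardSign xs v) by
      have hle := le_conUpdate (w := w) (ν := ν) (v := v) (z := z₁) hz₁X h.1
      rw [hz₁v] at hle
      refine ⟨0, 0, isInward_zero fun c' hc' => ?_, le_rfl, zero_le_one, by simp, ?_⟩
      · rcases eq_or_ne c' c with rfl | hne
        · simpa using h.2 hc'
        · simp [hne]
      · refine le_trans (le_of_eq (Finset.sum_congr rfl fun u hu => ?_)) (hle.trans (by simp))
        rw [hz₁ne u (Finset.mem_erase.1 hu).1]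
    rcases inwardSign_eq_or (xs := xs) v with hv | hv
    -- The shift lowers the load, so z₁ is feasible. Were c tight at x*, then z₁ ≥ x* on c would
    -- give z₁ load at least b c, yet its load is at most b c - 1.
    · refine ⟨by rw [hsum₁, hv]; linarith, fun ht => ?_⟩
      have : ∑ u ∈ N, (extremeLetter X xs u : ℝ) ≤ ∑ u ∈ N, (z₁ u : ℝ) := by
        refine Finset.sum_le_sum fun u hu => Nat.cast_le.2 ?_
        rcases eq_or_ne u v with rfl | huv
        · have h1 := extremeLetter_add_one_le hv hβ'
          rify at h1 ⊢
          rw [hz₁v, cast_shift hβ', hv]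
          linarith
        · rw [hz₁ne u huv]
          exact extremeLetter_le_of_inwardSign fun h => hch u hu huv (by rw [h, hv])
      rw [hsum₁, hv] at this
      linarith
    -- The shift raises the load, but z₁ ≤ x* on c and x* is feasible.
    · refine ⟨?_, fun _ => by rw [hv]; norm_num⟩
      refine le_trans (Finset.sum_le_sum fun u hu => Nat.cast_le.2 ?_)
        (hxsum.le.trans hmemc)
      rcases eq_or_ne u v with rfl | huv
      · have h1 := add_one_le_extremeLetter hv (hzX u) hβ'
        rify at h1 ⊢
        rw [hz₁v, cast_shift hβ', hv]
        linarith
      · rw [hz₁ne u huv]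
        exact le_extremeLetter_of_inwardSign (hzX u) fun h => hch u hu huv (by rw [h, hv, neg_neg])

-- Degree at most two leaves at most one constraint besides c, so the path does not fork and e ≤ 1
-- persists. This also gives e(t + 1) ≤ 1 + et.
open Classical in
theorem var_exchange (hA : ∀ j i, A j i = 0 ∨ A j i = 1)
    {μ : C → V → ℕ → WithBot ℝ} {ω t : ℝ} {u : V} {c : C} {β : ℕ}
    (hcard : ((packingModel A b w X).nbrV u).card ≤ 2)
    (hμ : ∀ c', A c' u = 1 → μ c' u β ≠ ⊥ →
      ∃ y e, Exchange A b w X xs ω t (Pi.single c' (-inwardSign xs u)) (μ c' u β)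
        (μ c' u (shift xs u β)) y e)
    (hcu : A c u = 1) (hβ : β ≤ X u) (hβ' : β ≠ extremeLetter X xs u)
    (hbot : (packingModel A b w X).varUpdate μ u c β ≠ ⊥) :
    ∃ y e, Exchange A b w X xs ω (t + 1) (Pi.single c (inwardSign xs u))
      ((packingModel A b w X).varUpdate μ u c β)
      ((packingModel A b w X).varUpdate μ u c (shift xs u β)) y e := by
  have hsum : ∑ c' ∈ ((packingModel A b w X).nbrV u).erase c, μ c' u β ≠ ⊥ := fun h => by
    simp [varUpdate, h] at hbot
  obtain ⟨y, e, hy, he, he', hlen, hval⟩ := node_exchange (A := A) (b := b) (w := w) (ω := ω)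
    (t := t) (g := fun c' => μ c' u) hβ hβ' (S := ((packingModel A b w X).nbrV u).erase c)
    fun c' hc' => hμ c' (mem_nbrV.1 (Finset.mem_erase.1 hc').2) (withBot_ne_bot_of_sum hsum hc')
  have he1 : e ≤ 1 := by
    refine he'.trans ?_
    rw [Finset.card_erase_of_mem (mem_nbrV.2 hcu)]
    exact_mod_cast (by omega :
      ((packingModel A b w X).nbrV u).card - 1 ≤ 1)
  refine ⟨y, e, hy.mono fun c' => ?_, he, he1, by linarith, hval⟩
  rcases eq_or_ne c' c with rfl | hne
  · simp [hcu]
  · rcases hA c' u with h | h <;> simp [hne, h, mem_nbrV]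

-- A leaf sees only c, though u may lie in another constraint. With inward sign -1 the move of u
-- loads no constraint and enters y. With sign 1 it might overload the other constraint, so it is
-- left out and paid for by ω.
open Classical in
theorem varUpdate_zero_exchange {ω : ℝ} (hω : ∀ v, w v ≤ ω) {u : V} {c : C} {β : ℕ}
    (hA : ∀ j i, A j i = 0 ∨ A j i = 1)
    (hcu : A c u = 1) (hβ : β ≤ X u) (hβ' : β ≠ extremeLetter X xs u) :
    ∃ y e, Exchange A b w X xs ω 0 (Pi.single c (inwardSign xs u))
      ((packingModel A b w X).varUpdate ((packingModel A b w X).msgCV 0) u c β)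
      ((packingModel A b w X).varUpdate ((packingModel A b w X).msgCV 0) u c (shift xs u β))
      y e := by
  have hval : ∀ γ : ℕ, (packingModel A b w X).varUpdate ((packingModel A b w X).msgCV 0) u c γ =
      ((w u * γ : ℝ) : WithBot ℝ) := fun γ => by simp [varUpdate, msgCV, packingModel]
  simp only [hval]
  have hX : X u ≠ 0 := by
    have := extremeLetter_le (X := X) (xs := xs) u
    omega
  rcases inwardSign_eq_or (xs := xs) u with hu | hu
  · refine ⟨0, 1, isInward_zero fun c' _ => ?_, zero_le_one, le_rfl, by simp, ?_⟩
    · rw [hu]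
      by_cases h : c' = c <;> simp [h]
    · rw [cast_shift hβ', hu, ← WithBot.coe_add, WithBot.coe_le_coe]
      simp only [dotProduct_zero]
      linarith [hω u]
  · refine ⟨Pi.single u (inwardSign xs u), 0, isInward_single hX fun c' _ => ?_, le_rfl,
      zero_le_one, ?_, ?_⟩
    · rw [hu]
      rcases eq_or_ne c' c with rfl | h
      · simp [hcu]
      · rcases hA c' u with h' | h' <;> simp [h, h']
    · simp [Pi.single_apply, inwardSign_mul_self]
    · rw [cast_shift hβ', ← WithBot.coe_add, WithBot.coe_le_coe, dotProduct_single]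
      linarith

open Classical in
theorem varUpdate_msgCV_exchange {ω : ℝ} (hω : ∀ v, w v ≤ ω)
    (hA : ∀ j i, A j i = 0 ∨ A j i = 1) (hxs : ∀ i, xs i = 0 ∨ xs i = (X i : ℝ))
    (hmem : xs ∈ packingPolytope A b X)
    (hcard : ∀ v, ((packingModel A b w X).nbrV v).card ≤ 2) (t : ℕ) (u : V) (c : C)
    (β : ℕ) (hcu : A c u = 1) (hβ : β ≤ X u) (hβ' : β ≠ extremeLetter X xs u)
    (hbot : (packingModel A b w X).varUpdate ((packingModel A b w X).msgCV t) u c β ≠ ⊥) :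
    ∃ y e, Exchange A b w X xs ω t (Pi.single c (inwardSign xs u))
      ((packingModel A b w X).varUpdate ((packingModel A b w X).msgCV t) u c β)
      ((packingModel A b w X).varUpdate ((packingModel A b w X).msgCV t) u c (shift xs u β))
      y e := by
  induction t generalizing u c β with
  | zero =>
    rw [Nat.cast_zero]
    exact varUpdate_zero_exchange hω hA hcu hβ hβ'
  | succ t ih =>
    rw [Nat.cast_succ]
    exact var_exchange hA (hcard u) (fun c' hc' hb => con_exchange hA hxs hmem
      (fun u' β' h1 h2 h3 h4 => ih u' c' β' h1 h2 h3 h4) hc' hβ' hb) hcu hβ hβ' hbot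

/-- The point x* itself is admissible in every local maximum. -/
theorem msgCV_extremeLetter_ne_bot (hA : ∀ j i, A j i = 0 ∨ A j i = 1)
    (hxs : ∀ i, xs i = 0 ∨ xs i = (X i : ℝ)) (hmem : xs ∈ packingPolytope A b X) (t : ℕ) (c : C)
    (v : V) : (packingModel A b w X).msgCV t c v (extremeLetter X xs v) ≠ ⊥ := by
  classical
  induction t generalizing c v with
  | zero => simp [msgCV]
  | succ t ih =>
    refine ne_bot_of_le_ne_bot (withBot_sum_ne_bot fun u _ => ?_)
      (le_conUpdate (ν := (packingModel A b w X).varUpdate ((packingModel A b w X).msgCV t))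
        (z := extremeLetter X xs) extremeLetter_le ?_)
    · simp only [varUpdate, ne_eq, WithBot.add_eq_bot, WithBot.coe_ne_bot, false_or]
      exact withBot_sum_ne_bot fun c' _ => ih c' u
    · simp_rw [cast_extremeLetter hxs, ← mulVec_eq_sum hA]
      exact hmem.2 c

theorem belief_extremeLetter_ne_bot (hA : ∀ j i, A j i = 0 ∨ A j i = 1)
    (hxs : ∀ i, xs i = 0 ∨ xs i = (X i : ℝ)) (hmem : xs ∈ packingPolytope A b X) (t : ℕ)
    (v : V) : (packingModel A b w X).belief t v (extremeLetter X xs v) ≠ ⊥ := by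
  simp only [belief, ne_eq, WithBot.add_eq_bot, WithBot.coe_ne_bot, false_or]
  exact withBot_sum_ne_bot fun c _ => msgCV_extremeLetter_ne_bot hA hxs hmem t c v

theorem belief_lt_belief_shift (hA : ∀ j i, A j i = 0 ∨ A j i = 1)
    (hxs : ∀ i, xs i = 0 ∨ xs i = (X i : ℝ))
    (hopt : optSet (packingPolytope A b X) w = {xs})
    (hcard : ∀ v, ((packingModel A b w X).nbrV v).card ≤ 2)
    {ω : ℝ} (hω : ∀ v, w v ≤ ω) {t : ℕ}
    (ht : ω / cGap (packingPolytope A b X) w xs + 1 / 2 < (t + 1 : ℕ))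
    {v : V} {β : ℕ} (hβ : β ≤ X v) (hβ' : β ≠ extremeLetter X xs v)
    (hbot : (packingModel A b w X).belief (t + 1) v β ≠ ⊥) :
    (packingModel A b w X).belief (t + 1) v β <
      (packingModel A b w X).belief (t + 1) v (shift xs v β) := by
  classical
  have hmem : xs ∈ packingPolytope A b X := by
    have : xs ∈ optSet (packingPolytope A b X) w := by rw [hopt]; rfl
    exact this.1
  have hsum : ∑ c ∈ (packingModel A b w X).nbrV v,
      (packingModel A b w X).msgCV (t + 1) c v β ≠ ⊥ := fun h => by
    simp [belief, h] at hbot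
  obtain ⟨y, e, hy, he, he', hlen, hval⟩ := node_exchange (A := A) (b := b) (w := w) (ω := ω)
    (t := t) (g := fun c => (packingModel A b w X).msgCV (t + 1) c v) hβ hβ'
    (S := (packingModel A b w X).nbrV v) fun c hc => by
      have := con_exchange hA hxs hmem (fun u' β' h1 h2 h3 h4 =>
        varUpdate_msgCV_exchange hω hA hxs hmem hcard t u' c β' h1 h2 h3 h4)
        (mem_nbrV.1 hc) hβ' (withBot_ne_bot_of_sum hsum hc)
      exact this
  change (packingModel A b w X).belief (t + 1) v β ≤
    (packingModel A b w X).belief (t + 1) v (shift xs v β) + _ at hval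
  have hy0 : IsInward A b X xs y 0 := hy.mono fun c => by
    rcases hA c v with h | h <;> simp [h, mem_nbrV]
  have hne : y ≠ 0 := by
    rintro rfl
    simp only [Pi.zero_apply, mul_zero, Finset.sum_const_zero] at hlen
    have := mul_nonneg he (Nat.cast_nonneg (α := ℝ) t)
    linarith
  obtain ⟨hc, hwy⟩ := dotProduct_le_of_mem_feasibleCone hopt hy0.mem_feasibleCone hne
  rw [hy0.sum_abs] at hwy
  set κ := cGap (packingPolytope A b X) w xs
  have he2 : e ≤ 2 := he'.trans (by exact_mod_cast hcard v)
  have hneg : w ⬝ᵥ y + e * ω < 0 := by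
    -- There are t + 1 iterations here. The excess eκ/2 is at most the κ contributed by the root,
    -- because e ≤ 2; this is the source of the 1/2.
    have h1 : ω < (t + 1 / 2) * κ := by
      rw [← div_lt_iff₀ hc]
      push_cast at ht
      linarith
    have h2 : κ * (1 + e * t) ≤ κ * ∑ u, inwardSign xs u * y u := by gcongr
    rcases he.eq_or_lt with rfl | he
    · linarith
    · nlinarith [mul_lt_mul_of_pos_left h1 he, mul_le_mul_of_nonneg_right he2 hc.le]
  cases hp : (packingModel A b w X).belief (t + 1) v (shift xs v β) with
  | bot =>
    rw [hp, WithBot.bot_add, le_bot_iff] at hval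
    exact absurd hval hbot
  | coe r =>
    refine lt_of_le_of_lt hval ?_
    rw [hp, ← WithBot.coe_add, WithBot.coe_lt_coe]
    linarith

/-- Negative weights and b ≥ 0 force x* = 0, and without iterations the belief is the decreasing
function w_v β. -/
theorem belief_zero_lt_belief_shift
    (hopt : optSet (packingPolytope A b X) w = {xs}) (hb : ∀ j, 0 ≤ b j) (hw : ∀ v, w v < 0)
    {v : V} {β : ℕ} (hβ' : β ≠ extremeLetter X xs v) :
    (packingModel A b w X).belief 0 v β <
      (packingModel A b w X).belief 0 v (shift xs v β) := by
  have hxs0 : xs = 0 := by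
    by_contra hne
    have h0 : (0 : V → ℝ) ∈ packingPolytope A b X :=
      ⟨fun v => by simp, fun c => by simpa using hb c⟩
    have hmem : xs ∈ optSet (packingPolytope A b X) w := by rw [hopt]; rfl
    have h1 := dotProduct_lt_of_optSet hopt h0 (Ne.symm hne)
    rw [dotProduct_zero] at h1
    exact h1.not_ge (Finset.sum_nonpos fun v _ =>
      mul_nonpos_of_nonpos_of_nonneg (hw v).le (hmem.1.1 v).1)
  have hval : ∀ γ : ℕ, (packingModel A b w X).belief 0 v γ = ((w v * γ : ℝ) : WithBot ℝ) :=
    fun γ => by simp [belief, msgCV, packingModel]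
  rw [hval, hval, WithBot.coe_lt_coe, cast_shift hβ', inwardSign, if_pos (by simp [hxs0])]
  linarith [hw v]

theorem minSumPacking_eq (t : ℕ) (v : V) {γ : ℕ}
    (hγ : (packingModel A b w X).belief t v γ ≠ ⊥) (hγX : γ ≤ X v)
    (h : ∀ β ≤ X v, β ≠ γ → (packingModel A b w X).belief t v β ≠ ⊥ →
      ∃ β' ≤ X v, (packingModel A b w X).belief t v β < (packingModel A b w X).belief t v β') :
    (packingModel A b w X).minSumPacking t v = γ := by
  have hle : ∀ β ≤ X v, (packingModel A b w X).belief t v β ≤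
      (packingModel A b w X).beliefMax t v := fun β hβ =>
    Finset.le_sup (Finset.mem_range.2 (Nat.lt_succ_of_le hβ))
  have hdelta : ∀ β ∈ (packingModel A b w X).delta t v, β = γ := by
    intro β hβ
    obtain ⟨hβX, hmax⟩ := Finset.mem_filter.1 hβ
    by_contra hne
    -- A maximizer has finite belief because γ does.
    obtain ⟨β', hβ'X, hlt⟩ := h β (Nat.le_of_lt_succ (Finset.mem_range.1 hβX)) hne
      (ne_bot_of_le_ne_bot hγ (hmax ▸ hle γ hγX))
    exact (hlt.trans_le (hle β' hβ'X)).ne hmax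
  unfold minSumPacking
  split_ifs
  · exact hdelta _ (Finset.max'_mem _ _)
  · exact hdelta _ (Finset.min'_mem _ _)

end Exchange

end MinSumPacking

theorem mainTheorem5 {m n : ℕ} (A : Matrix (Fin m) (Fin n) ℝ) (b : Fin m → ℝ)
    (w : Fin n → ℝ) (X : Fin n → ℕ)
    (hA : ∀ j i, A j i = 0 ∨ A j i = 1)
    (hb : ∀ j, 0 ≤ b j)
    (hcol : ∀ i, {j | A j i = 1}.ncard ≤ 2)
    (xs : Fin n → ℝ)
    (hopt : MinSumPacking.optSet (MinSumPacking.packingPolytope A b X) w = {xs})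
    (hxs : ∀ i, xs i = 0 ∨ xs i = (X i : ℝ))
    (t : ℕ)
    (ht : MinSumPacking.wMax w /
        MinSumPacking.cGap (MinSumPacking.packingPolytope A b X) w xs + 1 / 2 < (t : ℝ)) :
    ∀ i, (((MinSumPacking.packingModel A b w X).minSumPacking t i : ℕ) : ℝ) = xs i := by
  intro i
  have hmem : xs ∈ MinSumPacking.packingPolytope A b X := by
    have : xs ∈ MinSumPacking.optSet (MinSumPacking.packingPolytope A b X) w := by
      rw [hopt]
      rfl
    exact this.1
  have hω : ∀ v, w v ≤ MinSumPacking.wMax w := le_ciSup (Set.finite_range w).bddAbove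
  have hcard : ∀ v, ((MinSumPacking.packingModel A b w X).nbrV v).card ≤ 2 := by
    intro v
    refine le_trans (le_of_eq ?_) (hcol v)
    rw [← Set.ncard_coe_finset]
    congr 1
    ext j
    simp [MinSumPacking.mem_nbrV]
  rw [← MinSumPacking.cast_extremeLetter hxs i, Nat.cast_inj]
  refine MinSumPacking.minSumPacking_eq t i
    (MinSumPacking.belief_extremeLetter_ne_bot hA hxs hmem t i)
    (MinSumPacking.extremeLetter_le i) fun β hβ hne hbot =>
      ⟨MinSumPacking.shift xs i β, MinSumPacking.shift_le hβ hne, ?_⟩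
  cases t with
  | zero =>
    -- For t = 0 the hypothesis makes the quotient negative, so w_max < 0 because `cGap` is
    -- nonnegative.
    refine MinSumPacking.belief_zero_lt_belief_shift hopt hb (fun v => ?_) hne
    refine (hω v).trans_lt (not_le.1 fun h0 => ?_)
    have := div_nonneg h0 (MinSumPacking.cGap_nonneg hopt)
    rw [Nat.cast_zero] at ht
    linarith
  | succ t => exact MinSumPacking.belief_lt_belief_shift hA hxs hopt hcard hω ht hβ hne hbot
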